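/- **Model.** Consider a transmitter with one carrier ($N=1$), a battery with levels $\mathcal E=\{0,\dots,e_{\max}\}$ and slotted time. The numbers $B$ of energy quanta harvested in the slots are i.i.d. with values in $\{0,\dots,b_{\max}\}$. The legitimate power gains $G$ are i.i.d. over time, independent of the harvesting, with a law $P_G$ on $[0,\infty)$ of finite mean (for instance the Gamma law of Nakagami fading, or a finite discretization of it). The eavesdropper gain $H$ is independent of these and has the Gamma law of Nakagami fading with index $m\ge1$ and mean $\bar h>0$, with density $f_H(h)=(m/\bar h)^m\,\Gamma(m)^{-1}h^{m-1}e^{-mh/\bar h}$ for $h\ge 0$. The transmitter knows the current level $e$ and gain $g$, but only the law of $H$. Put $$T^{\rm con}(g,\rho)=\int_0^\infty\log_2\frac{1+g\rho}{1+h\rho}\,f_H(h)\,dh,\qquad T^{\rm var}(g,\rho)=\int_0^\infty\Big[\log_2\frac{1+g\rho}{1+h\rho}\Big]^+f_H(h)\,dh$$ (constant-rate and variable-rate coding, where $[x]^+=\max\{0,x\}$), and let $T$ be either of the two. A policy $\rho$ gives for each level $e$ a measurable function $g\mapsto\rho_{e,g}\in\{0,\dots,e\}$, the number of quanta spent. The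 battery level then evolves as the Markov chain $E^{(k+1)}=\min\{E^{(k)}-\rho_{E^{(k)},G^{(k)}}+B^{(k)},\,e_{\max}\}$, and $\pi_\rho(e\mid e_0)=\liminf_{K\to\infty}\frac1{K+1}\sum_{k=0}^K\mathbb P(E^{(k)}=e\mid E^{(0)}=e_0)$. The long-term secrecy rate of $\rho$ is $$C_\rho(e_0)=\sum_{e\in\mathcal E}\pi_\rho(e\mid e_0)\int T(g,\rho_{e,g})\,dP_G(g).$$ A policy is unichain if its battery chain has a single recurrent class. An optimal secrecy policy (OSP), for a given initial level $e_0$, is a unichain policy that maximizes $C_\rho(e_0)$ among all unichain policies. **Theorem.** 1. (Monotonicity, for constant-rate and for variable-rate coding.) Let $\rho$ be an OSP. There is a set $S$ with $P_G(S)=1$ such that for every recurrent battery level $e$ and all $g',g''\in S$ with $g'\le g''$ one has $\rho_{e,g'}\le\rho_{e,g''}$. If moreover $\rho$ uses no power at the transient levels, then there is an OSP $\rho'$ that also uses no power at its transient levels, agrees with $\rho$ for $P_G$-almost every $g$ at all levels, and satisfies $\rho'_{e,g'}\le\rho'_{e,g''}$ for all levels $e$ and all $g'\le g''$. 2. (Mixed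 partial derivatives.) For all real $m\ge1$, $\bar h>0$ and all $g\ge0$, $\rho\ge0$ (with one-sided derivatives on the boundary of the quadrant), $$\frac{\partial^2 T^{\rm con}}{\partial\rho\,\partial g}(g,\rho)=\frac1{\log2}\,\frac1{(1+g\rho)^2}\ \ge\ 0,\qquad \frac{\partial^2 T^{\rm var}}{\partial\rho\,\partial g}(g,\rho)=\frac1{\log 2}\,\frac{\Gamma(m)-\Gamma(m,mg/\bar h)}{(1+g\rho)^2\,\Gamma(m)}\ \ge\ 0,$$ where the derivative in $g$ is taken first, $\log$ is the natural logarithm and $\Gamma(m,z)=\int_z^\infty e^{-t}t^{m-1}\,dt$. -/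

import Mathlib

open MeasureTheory ProbabilityTheory Filter Set

noncomputable section

namespace EHSecrecy

/-- The two coding strategies: constant rate and variable rate. -/
inductive Coding where
  | con
  | var

/-- Instantaneous secrecy rate (in bits) with legitimate gain `g`, eavesdropper gain `h` and
transmission power `ρ`; negative values are kept for constant rate coding. -/
def instRate : Coding → ℝ → ℝ → ℝ → ℝ
  | .con, g, h, ρ => Real.logb 2 ((1 + g * ρ) / (1 + h * ρ))
  | .var, g, h, ρ => max 0 (Real.logb 2 ((1 + g * ρ) / (1 + h * ρ)))

/-- Law of a channel power gain under Nakagami fading of index `m` and mean gain `mean`: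
the Gamma distribution of shape `m` and rate `m / mean`. -/
def nakagamiGain (m mean : ℝ) : Measure ℝ := gammaMeasure m (m / mean)

/-- `T(g, ρ)`: the secrecy rate averaged over the unknown eavesdropper gain, which has index `m`
and mean `hbar`. -/
def expectedReward (c : Coding) (m hbar g ρ : ℝ) : ℝ :=
  ∫ h, instRate c g h ρ ∂(nakagamiGain m hbar)

/-- The upper incomplete Gamma function. -/
def upperGamma (m z : ℝ) : ℝ := ∫ t in Ioi z, Real.exp (-t) * t ^ (m - 1)

/-- On the closed quadrant `g, ρ ≥ 0`, the function `T` (of `g` and `ρ`) has a partial derivative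
in `g`, which in turn has a partial derivative in `ρ`, equal to `M`
(one-sided derivatives on the boundary). -/
def HasMixedPartial (T M : ℝ → ℝ → ℝ) : Prop :=
  ∃ D : ℝ → ℝ → ℝ, ∀ g ρ : ℝ, 0 ≤ g → 0 ≤ ρ →
    HasDerivWithinAt (fun x => T x ρ) (D g ρ) (Ici 0) g ∧
    HasDerivWithinAt (fun r => D g r) (M g ρ) (Ici 0) ρ

/-- A single-carrier energy harvesting transmitter that observes the legitimate gain only. -/
structure Model where
  /-- battery size -/
  emax : ℕ
  /-- maximal number of energy quanta harvested in a slot -/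
  bmax : ℕ
  /-- law of the number of quanta harvested in a slot -/
  harvest : PMF (Fin (bmax + 1))
  /-- law of the legitimate channel gain (continuous or discretized) -/
  gain : Measure ℝ
  gain_prob : IsProbabilityMeasure gain
  gain_nonneg : ∀ᵐ g ∂gain, 0 ≤ g
  gain_mean : Integrable (fun g : ℝ => g) gain
  /-- Nakagami index of the eavesdropper's channel -/
  m : ℝ
  one_le_m : 1 ≤ m
  /-- mean gain of the eavesdropper's channel -/
  hbar : ℝ
  hbar_pos : 0 < hbar
  /-- coding strategy in use -/
  coding : Coding

namespace Model

variable (M : Model)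

/-- Battery levels `0, …, emax`. -/
abbrev Level : Type := Fin (M.emax + 1)

/-- A deterministic policy: the number `ρ e g` of quanta spent with `e` quanta stored and
legitimate gain `g`. -/
def IsPolicy (ρ : M.Level → ℝ → ℕ) : Prop :=
  ∀ e, Measurable (ρ e) ∧ ∀ g, ρ e g ≤ (e : ℕ)

/-- Battery level after spending `x` quanta and harvesting `b` quanta. -/
def nextLevel (e : M.Level) (x b : ℕ) : M.Level :=
  ⟨min ((e : ℕ) - x + b) M.emax, Nat.lt_succ_of_le (min_le_right _ _)⟩

/-- Transition matrix of the battery level; the gain and the harvested energy of a slot are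
independent of each other and i.i.d. over time. -/
def transition (ρ : M.Level → ℝ → ℕ) : Matrix M.Level M.Level ℝ :=
  fun e e' => ∑ b, (M.harvest b).toReal * M.gain.real {g | M.nextLevel e (ρ e g) b = e'}

/-- `e'` is reached from `e` with positive probability in some number of steps. -/
def Reaches (ρ : M.Level → ℝ → ℕ) (e e' : M.Level) : Prop :=
  ∃ k : ℕ, 0 < (M.transition ρ ^ k) e e'

/-- Recurrent states of the (finite) battery chain; the other ones are transient. -/
def Recurrent (ρ : M.Level → ℝ → ℕ) (e : M.Level) : Prop :=
  ∀ e', M.Reaches ρ e e' → M.Reaches ρ e' e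

/-- The battery chain has a single recurrent class. -/
def Unichain (ρ : M.Level → ℝ → ℕ) : Prop :=
  ∀ e e', M.Recurrent ρ e → M.Recurrent ρ e' → M.Reaches ρ e e'

/-- Long-term fraction of time spent at level `e`, starting from level `e₀`. -/
def longTermProb (ρ : M.Level → ℝ → ℕ) (e₀ e : M.Level) : ℝ :=
  liminf (fun K : ℕ => (1 / ((K : ℝ) + 1)) *
    ∑ k ∈ Finset.range (K + 1), (M.transition ρ ^ k) e₀ e) atTop

/-- Long-term average secrecy rate `C` of a policy, starting from level `e₀`. -/
def secrecyRate (ρ : M.Level → ℝ → ℕ) (e₀ : M.Level) : ℝ :=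
  ∑ e, M.longTermProb ρ e₀ e *
    ∫ g, expectedReward M.coding M.m M.hbar g (ρ e g) ∂M.gain

/-- Optimal secrecy policy: a unichain policy whose long-term secrecy rate is maximal among all
unichain policies. -/
structure IsOSP (e₀ : M.Level) (ρ : M.Level → ℝ → ℕ) : Prop where
  policy : M.IsPolicy ρ
  unichain : M.Unichain ρ
  optimal : ∀ ρ', M.IsPolicy ρ' → M.Unichain ρ' → M.secrecyRate ρ' e₀ ≤ M.secrecyRate ρ e₀

/-- The normal form of a policy at the transient battery levels, whose actions do not influence
the long-term secrecy rate: no power is used there. -/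
def SilentOnTransient (ρ : M.Level → ℝ → ℕ) : Prop :=
  ∀ e, ¬ M.Recurrent ρ e → ∀ g, ρ e g = 0

end Model

end EHSecrecy

end

/-! Monotonicity combines a one-step deviation argument with strictly increasing differences. Let
`e` be recurrent for an OSP `ρ`, let `c` be its rate and let `v` solve the Poisson equation `c + v =
r + P v` (`exists_poisson`). Change the action at `e` to `a`, only at the gains where `a` strictly
improves present reward plus expected `v` of the next level. Every level still reaches `e`, so the
new policy is unichain, and its rate is `c + δ q`: `δ` is the mean improvement and `q > 0` the new
long-term frequency of `e` (`exists_frequency_pos`). Optimality forces `δ = 0`, so `ρ e g` is a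
maximizer for almost every `g` (`IsOSP.exists_value`). The continuation value does not involve `g`,
while a difference of `T` between two powers increases strictly with `g`
(`strictMonoOn_expectedReward_sub`). Strictness makes every selection of maximizers nondecreasing,
whatever the ties. A running supremum over the good gains then gives a version monotone everywhere
(`monotoneEnvelope`). For the derivatives, `T` depends on `g` through the capacity `log₂ (1 + g ρ)`,
and the expected positive part of `y - X` has derivative `P(X < y)`. Variable-rate coding thus only
adds the factor `P(H < g)`, which is free of `ρ`. -/

noncomputable section

namespace EHSecrecy

/-! ### Finite Markov chains: reachability, Poisson equation, long-term frequencies. -/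

section Chain

variable {ι : Type*} [Fintype ι] [DecidableEq ι] {P Q : Matrix ι ι ℝ}

/-- Reachability in the directed graph of the positive entries of the powers of a matrix. -/
def ChainReaches (P : Matrix ι ι ℝ) (i j : ι) : Prop := ∃ k : ℕ, 0 < (P ^ k) i j

open Matrix in
/-- If `A` is closed under the one-step transitions of `P`, then it is closed under
reachability. -/
lemma ChainReaches.mem_of_closed (hP : P ∈ rowStochastic ℝ ι) {A : Set ι}
    (hA : ∀ i ∈ A, ∀ j, 0 < P i j → j ∈ A) {i j : ι} (h : ChainReaches P i j) (hi : i ∈ A) :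
    j ∈ A := by
  obtain ⟨k, hk⟩ := h
  induction k generalizing i with
  | zero =>
    rw [pow_zero, Matrix.one_apply] at hk
    split_ifs at hk with hij
    · exact hij ▸ hi
    · exact absurd hk (lt_irrefl _)
  | succ k ih =>
    rw [pow_succ', Matrix.mul_apply] at hk
    obtain ⟨l, -, hl⟩ := Finset.exists_lt_of_sum_lt (s := Finset.univ)
      (f := fun _ : ι => (0 : ℝ)) (by simpa using hk)
    have h0 : 0 ≤ P i l := nonneg_of_mem_rowStochastic hP
    have h1 : 0 ≤ (P ^ k) l j := nonneg_of_mem_rowStochastic (pow_mem hP k)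
    have h2 : 0 < P i l := h0.lt_of_ne fun h => by rw [← h] at hl; simp at hl
    have h3 : 0 < (P ^ k) l j := h1.lt_of_ne fun h => by rw [← h] at hl; simp at hl
    exact ih (hA i hi l h2) h3

lemma ChainReaches.refl (i : ι) : ChainReaches P i i := ⟨0, by simp⟩

open Matrix in
lemma ChainReaches.trans (hP : P ∈ rowStochastic ℝ ι) {i j l : ι} (h : ChainReaches P i j)
    (h' : ChainReaches P j l) : ChainReaches P i l := by
  obtain ⟨a, ha⟩ := h
  obtain ⟨b, hb⟩ := h'
  refine ⟨a + b, ?_⟩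
  rw [pow_add, Matrix.mul_apply]
  refine (mul_pos ha hb).trans_le (Finset.single_le_sum
    (f := fun j => (P ^ a) i j * (P ^ b) j l) (fun x _ => ?_) (Finset.mem_univ j))
  exact mul_nonneg (nonneg_of_mem_rowStochastic (pow_mem hP a))
    (nonneg_of_mem_rowStochastic (pow_mem hP b))

open Matrix in
/-- Every state of a finite chain reaches a recurrent state. -/
lemma exists_chainReaches_recurrent (hP : P ∈ rowStochastic ℝ ι) (i : ι) :
    ∃ j, ChainReaches P i j ∧ ∀ l, ChainReaches P j l → ChainReaches P l j := by
  classical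
  -- Among the states reachable from `i`, one with the fewest reachable states is recurrent: a
  -- successor cannot reach strictly fewer.
  obtain ⟨j, hj, hmin⟩ := Finset.exists_min_image
    (Finset.univ.filter fun j => ChainReaches P i j)
    (fun j => (Finset.univ.filter fun l => ChainReaches P j l).card)
    ⟨i, by simp [ChainReaches.refl]⟩
  simp only [Finset.mem_filter, Finset.mem_univ, true_and] at hj hmin
  refine ⟨j, hj, fun l hl => ?_⟩
  have hsub : (Finset.univ.filter fun x => ChainReaches P l x) ⊆
      Finset.univ.filter fun x => ChainReaches P j x := fun x hx => by
    simp only [Finset.mem_filter, Finset.mem_univ, true_and] at hx ⊢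
    exact hl.trans hP hx
  have heq := Finset.eq_of_subset_of_card_le hsub (hmin l (hj.trans hP hl))
  have : j ∈ Finset.univ.filter fun x => ChainReaches P l x := by
    rw [heq]; simp [ChainReaches.refl]
  simpa using this

open Matrix in
/-- Changing the row of `e` does not affect whether all states reach `e`. -/
lemma ChainReaches.of_eq_off (hP : P ∈ rowStochastic ℝ ι) (hQ : Q ∈ rowStochastic ℝ ι) {e : ι}
    (hPQ : ∀ i, i ≠ e → Q i = P i) {i : ι} (h : ChainReaches P i e) : ChainReaches Q i e := by
  by_contra hi
  -- The states that do not reach `e` under `Q` are closed under `P`, since the two chains agree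
  -- away from `e`; yet `e` lies outside this set.
  refine h.mem_of_closed hP (A := {i | ¬ ChainReaches Q i e}) (fun i hi j hij hj => hi ?_) hi
    (ChainReaches.refl e)
  by_cases hie : i = e
  · rw [hie]
    exact ChainReaches.refl e
  · exact ChainReaches.trans hQ ⟨1, by rwa [pow_one, hPQ i hie]⟩ hj

open Matrix in
lemma abs_mulVec_le_norm (hP : P ∈ rowStochastic ℝ ι) (v : ι → ℝ) (i : ι) :
    |(P *ᵥ v) i| ≤ ‖v‖ := by
  calc |(P *ᵥ v) i| ≤ ∑ j, |P i j * v j| := Finset.abs_sum_le_sum_abs _ _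
    _ ≤ ∑ j, P i j * ‖v‖ := by
      refine Finset.sum_le_sum fun j _ => ?_
      rw [abs_mul, abs_of_nonneg (nonneg_of_mem_rowStochastic hP)]
      exact mul_le_mul_of_nonneg_left (norm_le_pi_norm v j) (nonneg_of_mem_rowStochastic hP)
    _ = ‖v‖ := by rw [← Finset.sum_mul, sum_row_of_mem_rowStochastic hP, one_mul]

/-- The average of `r` over the first `K + 1` steps of the chain started at `i`. -/
def cesaro (P : Matrix ι ι ℝ) (r : ι → ℝ) (i : ι) (K : ℕ) : ℝ :=
  (1 / ((K : ℝ) + 1)) * ∑ k ∈ Finset.range (K + 1), (Matrix.mulVec (P ^ k) r) i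

open Matrix in
/-- A solution of the Poisson equation identifies the limit of the time averages. -/
lemma tendsto_cesaro_of_poisson (hP : P ∈ rowStochastic ℝ ι) {r v : ι → ℝ} {c : ℝ}
    (h : ∀ i, c + v i = r i + (P *ᵥ v) i) (i : ι) :
    Tendsto (cesaro P r i) atTop (nhds c) := by
  have hr : r = (fun _ => c) + (v - P *ᵥ v) := by
    ext j; simp only [Pi.add_apply, Pi.sub_apply]; linarith [h j]
  have hconst : ∀ k : ℕ, P ^ k *ᵥ (fun _ => c) = fun _ => c := by
    intro k
    ext j
    simp only [mulVec, dotProduct]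
    rw [← Finset.sum_mul, sum_row_of_mem_rowStochastic (pow_mem hP k), one_mul]
  have hterm : ∀ k : ℕ, (P ^ k *ᵥ r) i = c + ((P ^ k *ᵥ v) i - (P ^ (k + 1) *ᵥ v) i) := by
    intro k
    rw [hr, mulVec_add, mulVec_sub, hconst, mulVec_mulVec, ← pow_succ]
    rfl
  -- The sum of `v - P v` along the chain telescopes, leaving a bounded boundary term divided by `K
  -- + 1`.
  have hces : ∀ K : ℕ, cesaro P r i K =
      c + (1 / ((K : ℝ) + 1)) * (v i - (P ^ (K + 1) *ᵥ v) i) := by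
    intro K
    have hK : (K : ℝ) + 1 ≠ 0 := by positivity
    unfold cesaro
    rw [Finset.sum_congr rfl fun k _ => hterm k, Finset.sum_add_distrib,
      Finset.sum_range_sub' (fun k => (P ^ k *ᵥ v) i)]
    simp only [Finset.sum_const, Finset.card_range, nsmul_eq_mul, pow_zero, one_mulVec]
    push_cast
    field_simp
  have hbdd : ∀ K : ℕ, ‖v i - (P ^ (K + 1) *ᵥ v) i‖ ≤ 2 * ‖v‖ := by
    intro K
    refine (norm_sub_le _ _).trans ?_
    have := abs_mulVec_le_norm (pow_mem hP (K + 1)) v i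
    have h2 := norm_le_pi_norm v i
    rw [Real.norm_eq_abs ((P ^ (K + 1) *ᵥ v) i)]
    linarith
  have hlim : Tendsto (fun K : ℕ => (1 / ((K : ℝ) + 1)) * (v i - (P ^ (K + 1) *ᵥ v) i)) atTop
      (nhds 0) :=
    tendsto_one_div_add_atTop_nhds_zero_nat.zero_mul_isBoundedUnder_le
      (isBoundedUnder_of ⟨2 * ‖v‖, hbdd⟩)
  rw [funext hces]
  simpa using hlim.const_add c

open Matrix in
/-- Minimum principle: the minimum of a superharmonic function is attained at `e`, and there the
function is harmonic, as soon as every state reaches `e`. -/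
lemma minimum_principle (hP : P ∈ rowStochastic ℝ ι) {e : ι} (he : ∀ i, ChainReaches P i e)
    {v : ι → ℝ} (hv : ∀ i, (P *ᵥ v) i ≤ v i) : (∀ i, v e ≤ v i) ∧ (P *ᵥ v) e = v e := by
  obtain ⟨i₀, -, hi₀⟩ := Finset.exists_min_image Finset.univ v ⟨e, Finset.mem_univ e⟩
  have hge : ∀ i, v i₀ ≤ (P *ᵥ v) i := by
    intro i
    calc v i₀ = ∑ j, P i j * v i₀ := by
          rw [← Finset.sum_mul, sum_row_of_mem_rowStochastic hP, one_mul]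
      _ ≤ (P *ᵥ v) i := Finset.sum_le_sum fun j _ =>
          mul_le_mul_of_nonneg_left (hi₀ j (Finset.mem_univ j)) (nonneg_of_mem_rowStochastic hP)
  -- At a minimizer the nonnegative excesses `v l - v i₀` average to zero, so all successors are
  -- minimizers too.
  have hclosed : ∀ i ∈ {i | v i = v i₀}, ∀ j, 0 < P i j → j ∈ {i | v i = v i₀} := by
    intro i hi j hij
    have hsum : ∑ l, P i l * (v l - v i₀) = 0 := by
      have h1 : ∑ l, P i l * (v l - v i₀) = (P *ᵥ v) i - v i₀ := by
        simp only [mul_sub, Finset.sum_sub_distrib]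
        rw [← Finset.sum_mul, sum_row_of_mem_rowStochastic hP, one_mul]
        rfl
      have h2 := hv i
      have h3 := hge i
      rw [mem_ofPred_eq] at hi
      linarith
    have hz := (Finset.sum_eq_zero_iff_of_nonneg fun l _ => mul_nonneg
      (nonneg_of_mem_rowStochastic hP) (sub_nonneg.2 (hi₀ l (Finset.mem_univ l)))).1 hsum j
      (Finset.mem_univ j)
    rcases mul_eq_zero.1 hz with h | h
    · exact absurd h hij.ne'
    · exact sub_eq_zero.1 h
  have hmem : v e = v i₀ := (he i₀).mem_of_closed hP hclosed rfl
  exact ⟨fun i => hmem ▸ hi₀ i (Finset.mem_univ i),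
    le_antisymm (hv e) (hmem ▸ hge e)⟩

open Matrix in
/-- The Poisson equation is solvable if some state is reached from everywhere. -/
lemma exists_poisson (hP : P ∈ rowStochastic ℝ ι) {e : ι} (he : ∀ i, ChainReaches P i e)
    (r : ι → ℝ) : ∃ (c : ℝ) (v : ι → ℝ), ∀ i, c + v i = r i + (P *ᵥ v) i := by
  -- Constants lie in the kernel of `1 - P`. Adding the functional `v e` makes the operator
  -- injective, hence surjective, and a preimage of `r` solves the equation with `c = v e`.
  let L : (ι → ℝ) →ₗ[ℝ] (ι → ℝ) :=
    LinearMap.id - P.mulVecLin + LinearMap.pi fun _ => LinearMap.proj e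
  have hL : ∀ v i, L v i = v i - (P *ᵥ v) i + v e := fun v i => rfl
  have hinj : Function.Injective L := by
    rw [← LinearMap.ker_eq_bot, LinearMap.ker_eq_bot']
    intro v hv
    have h0 : ∀ i, v e + v i = (0 : ι → ℝ) i + (P *ᵥ v) i := by
      intro i
      have := congrFun hv i
      rw [hL] at this
      simp only [Pi.zero_apply] at this ⊢
      linarith
    have hlim := tendsto_cesaro_of_poisson hP h0 e
    have hz : cesaro P (0 : ι → ℝ) e = fun _ => 0 := by
      ext K; simp [cesaro]
    rw [hz] at hlim
    have hve : v e = 0 := (tendsto_nhds_unique tendsto_const_nhds hlim).symm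
    have hharm : ∀ i, (P *ᵥ v) i = v i := fun i => by
      have := h0 i
      simp only [hve, Pi.zero_apply] at this
      linarith
    have hlow := (minimum_principle hP he (v := v) fun i => (hharm i).le).1
    have hup := (minimum_principle hP he (v := -v) fun i => by
      rw [mulVec_neg, Pi.neg_apply, Pi.neg_apply, hharm i]).1
    ext i
    have h1 := hlow i
    have h2 := hup i
    simp only [Pi.neg_apply, hve, Pi.zero_apply] at h1 h2 ⊢
    linarith
  obtain ⟨v, hv⟩ := LinearMap.injective_iff_surjective.1 hinj r
  refine ⟨v e, v, fun i => ?_⟩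
  rw [← hv, hL]
  ring

open Matrix in
/-- A state reached from everywhere has positive long-term frequency. -/
lemma exists_frequency_pos (hP : P ∈ rowStochastic ℝ ι) {e : ι} (he : ∀ i, ChainReaches P i e) :
    ∃ c : ℝ, 0 < c ∧ ∀ i, Tendsto (cesaro P (Pi.single e 1) i) atTop (nhds c) := by
  obtain ⟨c, v, hv⟩ := exists_poisson hP he (Pi.single e 1)
  refine ⟨c, ?_, tendsto_cesaro_of_poisson hP hv⟩
  by_contra hc
  push Not at hc
  -- If `c ≤ 0`, then `v` is superharmonic, hence harmonic at `e`, and the Poisson equation there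
  -- gives `c = 1`.
  have hmin := minimum_principle hP he (v := v) fun i => by
    have h1 : (0 : ℝ) ≤ (Pi.single e 1 : ι → ℝ) i := by
      rw [Pi.single_apply]; split_ifs <;> norm_num
    linarith [hv i]
  have := hv e
  rw [Pi.single_eq_same, hmin.2] at this
  linarith

/-- Time averages depend linearly on the reward. -/
lemma cesaro_eq_sum (P : Matrix ι ι ℝ) (r : ι → ℝ) (i : ι) (K : ℕ) :
    cesaro P r i K = ∑ e, cesaro P (Pi.single e 1) i K * r e := by
  simp only [cesaro, Matrix.mulVec_single_one, Matrix.col_apply]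
  simp only [mul_assoc, ← Finset.mul_sum, Finset.sum_mul]
  rw [Finset.sum_comm]
  rfl

end Chain

/-! ### Expected secrecy reward: derivatives, increasing differences, integrability. -/

section Reward

lemma isProbabilityMeasure_nakagamiGain {m hbar : ℝ} (hm : 1 ≤ m) (hh : 0 < hbar) :
    IsProbabilityMeasure (nakagamiGain m hbar) :=
  isProbabilityMeasure_gammaMeasure (by linarith) (div_pos (by linarith) hh)

lemma nakagamiGain_nonneg (m hbar : ℝ) : ∀ᵐ h ∂(nakagamiGain m hbar), 0 ≤ h := by
  rw [ae_iff]
  have : {h : ℝ | ¬ 0 ≤ h} = Iio 0 := by ext; simp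
  rw [this, nakagamiGain, gammaMeasure, withDensity_apply _ measurableSet_Iio,
    lintegral_gammaPDF_of_nonpos le_rfl]

/-- The law has no atoms, so the kink of the positive part at `h = g` is negligible. -/
lemma nakagamiGain_ne (m hbar g : ℝ) : ∀ᵐ h ∂(nakagamiGain m hbar), h ≠ g := by
  rw [ae_iff]
  refine (withDensity_absolutelyContinuous _ _ : nakagamiGain m hbar ≪ volume) ?_
  simp

lemma integrable_nakagamiGain {m hbar : ℝ} (hm : 1 ≤ m) (hh : 0 < hbar) :
    Integrable (fun h : ℝ => h) (nakagamiGain m hbar) := by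
  have hr : 0 < m / hbar := div_pos (by linarith) hh
  rw [nakagamiGain, gammaMeasure]
  unfold gammaPDF
  rw [integrable_withDensity_iff_integrable_smul₀' (by fun_prop) (by simp)]
  have h1 : IntegrableOn (fun x : ℝ => x ^ m * Real.exp (-(m / hbar) * x ^ (1 : ℝ))) (Ioi 0) :=
    integrableOn_rpow_mul_exp_neg_mul_rpow (by linarith) one_pos hr
  rw [← integrableOn_Ici_iff_integrableOn_Ioi] at h1
  have h2 := (integrable_indicator_iff measurableSet_Ici).2
    (h1.const_mul ((m / hbar) ^ m / Real.Gamma m))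
  refine h2.congr (ae_of_all _ fun x => ?_)
  simp only [smul_eq_mul]
  rw [ENNReal.toReal_ofReal (gammaPDFReal_nonneg (by linarith) hr x)]
  by_cases hx : 0 ≤ x
  · rw [indicator_of_mem (mem_Ici.2 hx), gammaPDFReal, if_pos hx, Real.rpow_one]
    rcases hx.eq_or_lt with rfl | hx'
    · rw [Real.zero_rpow (by linarith)]
      simp
    · rw [Real.rpow_sub_one hx'.ne', neg_mul]
      field_simp
  · rw [indicator_of_notMem (by simpa using hx), gammaPDFReal, if_neg hx, zero_mul]

/-- Rescaling by `m / hbar` turns the upper tail into the incomplete Gamma integral; the point `g`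
itself carries no mass. -/
lemma nakagamiGain_real_Iio {m hbar g : ℝ} (hm : 1 ≤ m) (hh : 0 < hbar) (hg : 0 ≤ g) :
    (nakagamiGain m hbar).real (Iio g) =
      (Real.Gamma m - upperGamma m (m * g / hbar)) / Real.Gamma m := by
  have hr : 0 < m / hbar := div_pos (by linarith) hh
  have hG : 0 < Real.Gamma m := Real.Gamma_pos_of_pos (by linarith)
  have := isProbabilityMeasure_nakagamiGain hm hh
  have hIoi : (nakagamiGain m hbar).real (Ioi g) = upperGamma m (m * g / hbar) / Real.Gamma m := by
    have h1 : (nakagamiGain m hbar).real (Ioi g) =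
        ∫ x in Ioi g, gammaPDFReal m (m / hbar) x := by
      rw [measureReal_def, nakagamiGain, gammaMeasure, withDensity_apply _ measurableSet_Ioi,
        integral_eq_lintegral_of_nonneg_ae
          (ae_of_all _ (gammaPDFReal_nonneg (by linarith) hr)) (by fun_prop)]
      rfl
    have h2 : ∫ x in Ioi g, gammaPDFReal m (m / hbar) x =
        ∫ x in Ioi g, (fun t => (m / hbar) / Real.Gamma m * (Real.exp (-t) * t ^ (m - 1)))
          ((m / hbar) * x) := by
      refine setIntegral_congr_fun measurableSet_Ioi fun x hx => ?_
      have hx0 : 0 < x := lt_of_le_of_lt hg hx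
      simp only [gammaPDFReal]
      rw [if_pos hx0.le, Real.mul_rpow hr.le hx0.le, Real.rpow_sub_one hr.ne']
      field_simp
    rw [h1, h2]
    refine (integral_comp_mul_left_Ioi
      (fun t => (m / hbar) / Real.Gamma m * (Real.exp (-t) * t ^ (m - 1))) g hr).trans ?_
    rw [integral_const_mul, upperGamma, show m / hbar * g = m * g / hbar by ring]
    simp only [smul_eq_mul]
    have : m ≠ 0 := by linarith
    field_simp
  have hcompl : (nakagamiGain m hbar).real (Iio g) = 1 - (nakagamiGain m hbar).real (Ioi g) := by
    rw [← probReal_compl_eq_one_sub measurableSet_Ioi, compl_Ioi]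
    refine measureReal_congr ?_
    filter_upwards [nakagamiGain_ne m hbar g] with x hx
    exact propext ⟨fun h : x < g => h.le, fun h : x ≤ g => lt_of_le_of_ne h hx⟩
  rw [hcompl, hIoi]
  field_simp

/-- The density is positive on `(0, g)`. This is the source of strictness for variable-rate coding.
-/
lemma nakagamiGain_real_Iio_pos {m hbar g : ℝ} (hm : 1 ≤ m) (hh : 0 < hbar) (hg : 0 < g) :
    0 < (nakagamiGain m hbar).real (Iio g) := by
  have hr : 0 < m / hbar := div_pos (by linarith) hh
  have := isProbabilityMeasure_nakagamiGain hm hh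
  refine measureReal_nonneg.lt_of_ne fun h => ?_
  rw [eq_comm, measureReal_eq_zero_iff, nakagamiGain, gammaMeasure] at h
  have hmeas : Measurable (gammaPDF m (m / hbar)) :=
    (measurable_gammaPDFReal m (m / hbar)).ennreal_ofReal
  rw [withDensity_apply_eq_zero hmeas] at h
  have hsub : Ioo 0 g ⊆ {x | gammaPDF m (m / hbar) x ≠ 0} ∩ Iio g := fun x hx =>
    ⟨(ENNReal.ofReal_pos.2 (gammaPDFReal_pos (by linarith) hr hx.1)).ne', hx.2⟩
  have h0 := measure_mono_null hsub h
  rw [Real.volume_Ioo, ENNReal.ofReal_eq_zero] at h0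
  linarith

/-- Derivative of the expected positive part of `y - X`. -/
lemma hasDerivAt_integral_max {Ω : Type*} [MeasurableSpace Ω] {μ : Measure Ω}
    [IsProbabilityMeasure μ] {X : Ω → ℝ} (hX : Measurable X) (hXi : Integrable X μ) {y : ℝ}
    (hy : ∀ᵐ ω ∂μ, X ω ≠ y) :
    HasDerivAt (fun y => ∫ ω, max 0 (y - X ω) ∂μ) (μ.real {ω | X ω < y}) y := by
  have hmeas : MeasurableSet {ω | X ω < y} := measurableSet_lt hX measurable_const
  -- The integrand is 1-Lipschitz in `y`, and almost surely `y` is not its kink.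
  have h := (hasDerivAt_integral_of_dominated_loc_of_lip (μ := μ) (𝕜 := ℝ)
    (F := fun y ω => max 0 (y - X ω)) (x₀ := y) (s := univ) (bound := fun _ => 1)
    (F' := {ω | X ω < y}.indicator fun _ => (1 : ℝ)) univ_mem
    (Eventually.of_forall fun x => by fun_prop)
    (((integrable_const y).sub hXi).pos_part.congr (ae_of_all _ fun ω => by
      simp [max_comm]))
    (measurable_const.indicator hmeas).aestronglyMeasurable ?_ (integrable_const _) ?_).2
  · rwa [integral_indicator hmeas, setIntegral_const, smul_eq_mul, mul_one] at h
  · refine ae_of_all _ fun ω => LipschitzWith.lipschitzOnWith ?_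
    have h1 : LipschitzWith 1 (fun y : ℝ => y - X ω) :=
      LipschitzWith.of_dist_le_mul fun a b => by simp
    simpa using h1.const_max 0
  · filter_upwards [hy] with ω hω
    rcases lt_or_gt_of_ne hω with hlt | hgt
    · rw [indicator_of_mem (show ω ∈ {ω | X ω < y} from hlt)]
      refine ((hasDerivAt_id y).sub_const (X ω)).congr_of_eventuallyEq ?_
      filter_upwards [lt_mem_nhds hlt] with z hz
      exact max_eq_right (by simpa using hz.le)
    · rw [indicator_of_notMem (show ω ∉ {ω | X ω < y} from fun h => lt_asymm h hgt)]
      refine (hasDerivAt_const y (0 : ℝ)).congr_of_eventuallyEq ?_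
      filter_upwards [gt_mem_nhds hgt] with z hz
      exact max_eq_left (by linarith)

/-- The capacity `log₂ (1 + g ρ)` of a channel of gain `g` at power `ρ`. -/
def capacity (ρ g : ℝ) : ℝ := Real.logb 2 (1 + g * ρ)

lemma measurable_capacity (ρ : ℝ) : Measurable (capacity ρ) := by
  unfold capacity Real.logb; fun_prop

lemma capacity_nonneg {ρ g : ℝ} (hρ : 0 ≤ ρ) (hg : 0 ≤ g) : 0 ≤ capacity ρ g :=
  Real.logb_nonneg one_lt_two (by nlinarith)

lemma capacity_le {ρ g : ℝ} (hρ : 0 ≤ ρ) (hg : 0 ≤ g) :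
    capacity ρ g ≤ g * ρ / Real.log 2 := by
  have h := Real.log_le_sub_one_of_pos (show 0 < 1 + g * ρ by nlinarith)
  exact div_le_div_of_nonneg_right (by linarith) (Real.log_pos one_lt_two).le

lemma capacity_strictMonoOn {ρ : ℝ} (hρ : 0 < ρ) : StrictMonoOn (capacity ρ) (Ici 0) := by
  intro x hx y hy hxy
  have hx0 : (0 : ℝ) ≤ x := hx
  exact Real.logb_lt_logb one_lt_two (by positivity) (by nlinarith)

lemma hasDerivAt_capacity {ρ g : ℝ} (hρ : 0 ≤ ρ) (hg : 0 ≤ g) :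
    HasDerivAt (capacity ρ) (ρ / (1 + g * ρ) / Real.log 2) g := by
  have h1 : HasDerivAt (fun x : ℝ => 1 + x * ρ) ρ g := by
    simpa using ((hasDerivAt_id g).mul_const ρ).const_add 1
  exact (h1.log (by positivity)).div_const (Real.log 2)

lemma logb_div_eq_capacity_sub {g h ρ : ℝ} (hρ : 0 ≤ ρ) (hg : 0 ≤ g) (hh : 0 ≤ h) :
    Real.logb 2 ((1 + g * ρ) / (1 + h * ρ)) = capacity ρ g - capacity ρ h :=
  Real.logb_div (by positivity) (by positivity)

lemma integrable_capacity {m hbar ρ : ℝ} (hm : 1 ≤ m) (hh : 0 < hbar) (hρ : 0 ≤ ρ) :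
    Integrable (capacity ρ) (nakagamiGain m hbar) := by
  refine (((integrable_nakagamiGain hm hh).mul_const ρ).div_const (Real.log 2)).mono'
    (measurable_capacity ρ).aestronglyMeasurable ?_
  filter_upwards [nakagamiGain_nonneg m hbar] with h h0
  rw [Real.norm_of_nonneg (capacity_nonneg hρ h0)]
  exact capacity_le hρ h0

lemma expectedReward_con {m hbar g ρ : ℝ} (hm : 1 ≤ m) (hh : 0 < hbar) (hg : 0 ≤ g)
    (hρ : 0 ≤ ρ) : expectedReward .con m hbar g ρ =
      capacity ρ g - ∫ h, capacity ρ h ∂(nakagamiGain m hbar) := by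
  have := isProbabilityMeasure_nakagamiGain hm hh
  have h1 : expectedReward .con m hbar g ρ =
      ∫ h, (capacity ρ g - capacity ρ h) ∂(nakagamiGain m hbar) := by
    refine integral_congr_ae ?_
    filter_upwards [nakagamiGain_nonneg m hbar] with h h0
    exact logb_div_eq_capacity_sub hρ hg h0
  rw [h1, integral_sub (integrable_const _) (integrable_capacity hm hh hρ)]
  simp

lemma expectedReward_var {m hbar g ρ : ℝ} (hg : 0 ≤ g) (hρ : 0 ≤ ρ) :
    expectedReward .var m hbar g ρ =
      ∫ h, max 0 (capacity ρ g - capacity ρ h) ∂(nakagamiGain m hbar) := by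
  refine integral_congr_ae ?_
  filter_upwards [nakagamiGain_nonneg m hbar] with h h0
  simp only [instRate, logb_div_eq_capacity_sub hρ hg h0]

/-- The probability that secrecy bits are counted when the legitimate gain is `g`: the
eavesdropper has to be weaker for variable rate coding. -/
def activeProb : Coding → ℝ → ℝ → ℝ → ℝ
  | .con, _, _, _ => 1
  | .var, m, hbar, g => (nakagamiGain m hbar).real (Iio g)

lemma activeProb_pos (c : Coding) {m hbar g : ℝ} (hm : 1 ≤ m) (hh : 0 < hbar) (hg : 0 < g) :
    0 < activeProb c m hbar g := by
  cases c
  · exact one_pos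
  · exact nakagamiGain_real_Iio_pos hm hh hg

/-- The partial derivative of the expected reward in the legitimate gain. -/
lemma hasDerivWithinAt_expectedReward (c : Coding) {m hbar g ρ : ℝ} (hm : 1 ≤ m)
    (hh : 0 < hbar) (hg : 0 ≤ g) (hρ : 0 ≤ ρ) :
    HasDerivWithinAt (fun x => expectedReward c m hbar x ρ)
      (activeProb c m hbar g * (ρ / (1 + g * ρ) / Real.log 2)) (Ici 0) g := by
  have hcap := hasDerivAt_capacity hρ hg
  cases c with
  | con =>
    rw [activeProb, one_mul]
    exact (hcap.sub_const _).hasDerivWithinAt.congr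
      (fun x hx => expectedReward_con hm hh hx hρ) (expectedReward_con hm hh hg hρ)
  | var =>
    refine HasDerivWithinAt.congr (f := fun x => ∫ h, max 0 (capacity ρ x - capacity ρ h)
      ∂(nakagamiGain m hbar)) ?_ (fun x hx => expectedReward_var hx hρ) (expectedReward_var hg hρ)
    rcases hρ.eq_or_lt with rfl | hρ'
    -- At zero power the capacity is constant and ties occur everywhere, so this case is separate.
    · have h0 : capacity 0 = fun _ => 0 := by ext x; simp [capacity]
      simpa [h0] using hasDerivWithinAt_const g (Ici 0) (0 : ℝ)
    · have := isProbabilityMeasure_nakagamiGain hm hh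
      have hne : ∀ᵐ h ∂(nakagamiGain m hbar), capacity ρ h ≠ capacity ρ g := by
        filter_upwards [nakagamiGain_nonneg m hbar, nakagamiGain_ne m hbar g] with h h0 h1 h2
        exact h1 ((capacity_strictMonoOn hρ').injOn h0 hg h2)
      have hprob : (nakagamiGain m hbar).real {h | capacity ρ h < capacity ρ g} =
          activeProb .var m hbar g := by
        refine measureReal_congr ?_
        filter_upwards [nakagamiGain_nonneg m hbar] with h h0
        exact propext ((capacity_strictMonoOn hρ').lt_iff_lt h0 hg)
      have hmax := hasDerivAt_integral_max (measurable_capacity ρ)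
        (integrable_capacity hm hh hρ) hne
      rw [hprob] at hmax
      exact (hmax.comp g hcap).hasDerivWithinAt

/-- The mixed partial derivative of the expected reward. -/
lemma hasMixedPartial_expectedReward (c : Coding) {m hbar : ℝ} (hm : 1 ≤ m) (hh : 0 < hbar) :
    HasMixedPartial (expectedReward c m hbar)
      (fun g ρ => activeProb c m hbar g * (1 / (1 + g * ρ) ^ 2 / Real.log 2)) := by
  refine ⟨fun g ρ => activeProb c m hbar g * (ρ / (1 + g * ρ) / Real.log 2), fun g ρ hg hρ =>
    ⟨hasDerivWithinAt_expectedReward c hm hh hg hρ, ?_⟩⟩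
  have h1 : HasDerivAt (fun r : ℝ => 1 + g * r) g ρ := by
    simpa using ((hasDerivAt_id ρ).const_mul g).const_add 1
  have h2 := (hasDerivAt_id ρ).div h1 (by positivity)
  refine (((h2.div_const (Real.log 2)).const_mul (activeProb c m hbar g)).congr_deriv
    ?_).hasDerivWithinAt
  simp only [id]
  ring

/-- The expected reward has strictly increasing differences. -/
lemma strictMonoOn_expectedReward_sub (c : Coding) {m hbar a b : ℝ} (hm : 1 ≤ m) (hh : 0 < hbar)
    (ha : 0 ≤ a) (hab : a < b) :
    StrictMonoOn (fun g => expectedReward c m hbar g b - expectedReward c m hbar g a)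
      (Ici 0) := by
  have hb : 0 ≤ b := ha.trans hab.le
  have hder : ∀ g : ℝ, 0 ≤ g → HasDerivWithinAt
      (fun g => expectedReward c m hbar g b - expectedReward c m hbar g a)
      (activeProb c m hbar g * (b / (1 + g * b) / Real.log 2) -
        activeProb c m hbar g * (a / (1 + g * a) / Real.log 2)) (Ici 0) g := fun g hg =>
    (hasDerivWithinAt_expectedReward c hm hh hg hb).sub
      (hasDerivWithinAt_expectedReward c hm hh hg ha)
  -- Positivity in the interior suffices; at `g = 0` the variable-rate factor vanishes.
  refine strictMonoOn_of_deriv_pos (convex_Ici 0)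
    (fun g hg => (hder g hg).continuousWithinAt) fun g hg => ?_
  rw [interior_Ici] at hg
  have hg0 : 0 < g := hg
  rw [((hder g hg0.le).hasDerivAt (Ici_mem_nhds hg0)).deriv, ← mul_sub]
  refine mul_pos (activeProb_pos c hm hh hg0) (sub_pos.2 ?_)
  refine div_lt_div_of_pos_right ?_ (Real.log_pos one_lt_two)
  rw [div_lt_div_iff₀ (by positivity) (by positivity)]
  nlinarith

lemma measurable_expectedReward (c : Coding) {m hbar : ℝ} (hm : 1 ≤ m) (hh : 0 < hbar) (ρ : ℝ) :
    Measurable fun g => expectedReward c m hbar g ρ := by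
  have := isProbabilityMeasure_nakagamiGain hm hh
  have h : Measurable (Function.uncurry fun g h => instRate c g h ρ) := by
    cases c <;> simp only [instRate, Real.logb] <;> fun_prop
  exact (h.stronglyMeasurable.integral_prod_right).measurable

/-- From `log (1 + x) ≤ x`: the bound is affine in `g`, so a finite mean gain makes the slot reward
integrable. -/
lemma abs_expectedReward_le (c : Coding) {m hbar g ρ : ℝ} (hm : 1 ≤ m) (hh : 0 < hbar)
    (hg : 0 ≤ g) (hρ : 0 ≤ ρ) : |expectedReward c m hbar g ρ| ≤
      (g + ∫ h, h ∂(nakagamiGain m hbar)) * ρ / Real.log 2 := by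
  have := isProbabilityMeasure_nakagamiGain hm hh
  have hint : Integrable (fun h => (g + h) * ρ / Real.log 2) (nakagamiGain m hbar) :=
    (((integrable_const g).add (integrable_nakagamiGain hm hh)).mul_const ρ).div_const _
  have hval : ∫ h, (g + h) * ρ / Real.log 2 ∂(nakagamiGain m hbar) =
      (g + ∫ h, h ∂(nakagamiGain m hbar)) * ρ / Real.log 2 := by
    rw [integral_div, integral_mul_const,
      integral_add (integrable_const g) (integrable_nakagamiGain hm hh)]
    simp
  rw [← hval]
  rw [← Real.norm_eq_abs]
  refine norm_integral_le_of_norm_le hint ?_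
  filter_upwards [nakagamiGain_nonneg m hbar] with h h0
  have hsub : |capacity ρ g - capacity ρ h| ≤ (g + h) * ρ / Real.log 2 := by
    have h1 := capacity_nonneg hρ hg
    have h2 := capacity_nonneg hρ h0
    have h3 := capacity_le hρ hg
    have h4 := capacity_le hρ h0
    rw [add_mul, add_div, abs_le]
    constructor <;> linarith
  cases c with
  | con => simpa only [instRate, logb_div_eq_capacity_sub hρ hg h0, Real.norm_eq_abs] using hsub
  | var =>
    simp only [instRate, logb_div_eq_capacity_sub hρ hg h0]
    rw [Real.norm_of_nonneg (le_max_left _ _)]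
    exact max_le ((abs_nonneg _).trans hsub) ((le_abs_self _).trans hsub)

end Reward

lemma cesaro_add_smul {ι : Type*} [Fintype ι] [DecidableEq ι] (P : Matrix ι ι ℝ) (r s : ι → ℝ)
    (δ : ℝ) (i : ι) (K : ℕ) :
    cesaro P (r + δ • s) i K = cesaro P r i K + δ * cesaro P s i K := by
  simp only [cesaro, Matrix.mulVec_add, Matrix.mulVec_smul, Pi.add_apply, Pi.smul_apply,
    smul_eq_mul, Finset.sum_add_distrib, ← Finset.mul_sum]
  ring

/-! ### The battery chain and its secrecy rate. -/

namespace Model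

variable (M : Model)

attribute [instance] Model.gain_prob

/-- Expected value of `v` after spending `x` quanta at level `e`. -/
def nextValue (v : M.Level → ℝ) (e : M.Level) (x : ℕ) : ℝ :=
  ∑ b, (M.harvest b).toReal * v (M.nextLevel e x b)

/-- Expected reward collected in a slot that starts at level `e`. -/
def levelReward (ρ : M.Level → ℝ → ℕ) (e : M.Level) : ℝ :=
  ∫ g, expectedReward M.coding M.m M.hbar g (ρ e g) ∂M.gain

lemma sum_harvest : ∑ b, (M.harvest b).toReal = 1 := by
  rw [← ENNReal.toReal_sum fun b _ => M.harvest.apply_ne_top b, ← tsum_fintype (L := .unconditional _),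
    M.harvest.tsum_coe, ENNReal.toReal_one]

variable {M} {ρ : M.Level → ℝ → ℕ}

lemma integrable_comp_nextLevel (v : M.Level → ℝ) (e : M.Level) (b : ℕ) {x : ℝ → ℕ}
    (hx : Measurable x) : Integrable (fun g => v (M.nextLevel e (x g) b)) M.gain :=
  Integrable.of_bound ((measurable_from_nat (f := fun a => v (M.nextLevel e a b))).comp
    hx).aestronglyMeasurable ‖v‖ (ae_of_all _ fun _ => norm_le_pi_norm v _)

lemma integrable_nextValue (v : M.Level → ℝ) (e : M.Level) {x : ℝ → ℕ} (hx : Measurable x) :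
    Integrable (fun g => M.nextValue v e (x g)) M.gain :=
  integrable_finsetSum _ fun b _ => (integrable_comp_nextLevel v e b hx).const_mul _

lemma integrable_expectedReward {x : ℝ → ℕ} (hx : Measurable x) {e : ℕ} (hxe : ∀ g, x g ≤ e) :
    Integrable (fun g => expectedReward M.coding M.m M.hbar g (x g)) M.gain := by
  have hmeas : Measurable fun p : ℝ × ℕ => expectedReward M.coding M.m M.hbar p.1 p.2 :=
    measurable_from_prod_countable_left fun a =>
      measurable_expectedReward M.coding M.one_le_m M.hbar_pos a
  refine Integrable.mono' (g := fun g => (g + ∫ h, h ∂(nakagamiGain M.m M.hbar)) * e / Real.log 2)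
    (((M.gain_mean.add (integrable_const _)).mul_const _).div_const _)
    (hmeas.comp (measurable_id.prodMk hx)).aestronglyMeasurable ?_
  filter_upwards [M.gain_nonneg] with g hg
  refine (abs_expectedReward_le M.coding M.one_le_m M.hbar_pos hg (Nat.cast_nonneg _)).trans ?_
  have h0 : 0 ≤ ∫ h, h ∂(nakagamiGain M.m M.hbar) :=
    integral_nonneg_of_ae (nakagamiGain_nonneg _ _)
  have h1 : (x g : ℝ) ≤ e := by exact_mod_cast hxe g
  have h2 := Real.log_pos one_lt_two
  gcongr

/-- Writing the expected next value as an integral over the gain lets it be compared with the reward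
gain by gain. -/
lemma transition_mulVec (hρ : M.IsPolicy ρ) (v : M.Level → ℝ) (e : M.Level) :
    (Matrix.mulVec (M.transition ρ) v) e = ∫ g, M.nextValue v e (ρ e g) ∂M.gain := by
  have hb : ∀ b : ℕ, ∫ g, v (M.nextLevel e (ρ e g) b) ∂M.gain =
      ∑ e', M.gain.real {g | M.nextLevel e (ρ e g) b = e'} * v e' := by
    intro b
    have hm : Measurable fun g => M.nextLevel e (ρ e g) b :=
      (measurable_from_nat (f := fun a => M.nextLevel e a b)).comp (hρ e).1
    have := Measure.isProbabilityMeasure_map (μ := M.gain) hm.aemeasurable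
    rw [← integral_map (f := v) hm.aemeasurable (measurable_of_finite v).aestronglyMeasurable,
      integral_fintype Integrable.of_finite]
    refine Finset.sum_congr rfl fun e' _ => ?_
    rw [map_measureReal_apply hm (measurableSet_singleton e'), smul_eq_mul]
    rfl
  unfold nextValue
  rw [integral_finsetSum _ fun (b : Fin (M.bmax + 1)) _ =>
    (integrable_comp_nextLevel v e b (hρ e).1).const_mul (M.harvest b).toReal]
  simp only [integral_const_mul, hb, Matrix.mulVec, dotProduct, transition, Finset.sum_mul,
    Finset.mul_sum]
  rw [Finset.sum_comm]
  simp only [mul_assoc]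

lemma transition_mem_rowStochastic (hρ : M.IsPolicy ρ) :
    M.transition ρ ∈ Matrix.rowStochastic ℝ M.Level := by
  refine Matrix.mem_rowStochastic.2 ⟨fun e e' => Finset.sum_nonneg fun b _ =>
    mul_nonneg ENNReal.toReal_nonneg measureReal_nonneg, ?_⟩
  ext e
  rw [transition_mulVec hρ]
  simp [nextValue, M.sum_harvest]

/-- All levels reach every recurrent level under a unichain policy. -/
lemma Unichain.reaches (hρ : M.IsPolicy ρ) (hu : M.Unichain ρ) {e : M.Level}
    (he : M.Recurrent ρ e) (i : M.Level) : ChainReaches (M.transition ρ) i e := by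
  obtain ⟨j, hij, hj⟩ := exists_chainReaches_recurrent (transition_mem_rowStochastic hρ) i
  exact hij.trans (transition_mem_rowStochastic hρ) (hu j e hj he)

/-- A recurrent level that reaches `e` is reached back from `e`, so recurrent levels communicate
through `e`. -/
lemma unichain_of_reaches (hρ : M.IsPolicy ρ) {e : M.Level}
    (he : ∀ i, ChainReaches (M.transition ρ) i e) : M.Unichain ρ := fun i j _ hj =>
  ChainReaches.trans (transition_mem_rowStochastic hρ) (he i) (hj e (he j))

/-- The secrecy rate is the limit of the expected time averages of the reward. -/
lemma secrecyRate_eq_of_tendsto (hρ : M.IsPolicy ρ) {e : M.Level}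
    (he : ∀ i, ChainReaches (M.transition ρ) i e) {e₀ : M.Level} {c : ℝ}
    (hc : Tendsto (cesaro (M.transition ρ) (M.levelReward ρ) e₀) atTop (nhds c)) :
    M.secrecyRate ρ e₀ = c := by
  -- The Poisson equation for each indicator reward shows that the lower limits in `longTermProb`
  -- are limits, hence additive.
  have hlim : ∀ j, ∃ q, Tendsto (cesaro (M.transition ρ) (Pi.single j 1) e₀) atTop (nhds q) :=
    fun j => by
      obtain ⟨q, v, hv⟩ := exists_poisson (transition_mem_rowStochastic hρ) he (Pi.single j 1)
      exact ⟨q, tendsto_cesaro_of_poisson (transition_mem_rowStochastic hρ) hv e₀⟩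
  choose q hq using hlim
  have hprob : ∀ j, M.longTermProb ρ e₀ j = q j := fun j => by
    rw [← (hq j).liminf_eq, longTermProb]
    congr 1
    funext K
    simp only [cesaro, Matrix.mulVec_single_one, Matrix.col_apply]
  have hsum : Tendsto (cesaro (M.transition ρ) (M.levelReward ρ) e₀) atTop
      (nhds (∑ j, q j * M.levelReward ρ j)) := by
    rw [funext (cesaro_eq_sum (M.transition ρ) (M.levelReward ρ) e₀)]
    exact tendsto_finsetSum _ fun j _ => (hq j).mul_const _
  rw [tendsto_nhds_unique hc hsum]
  simp only [secrecyRate, hprob]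
  rfl

/-! ### One-step deviations and monotone selection of maximizers. -/

/-- Bellman optimality of an OSP at a recurrent level: almost surely no admissible action improves
the sum of the present reward and the expected relative value of the next level. -/
lemma IsOSP.exists_value {e₀ : M.Level} (hosp : M.IsOSP e₀ ρ) {e : M.Level}
    (he : M.Recurrent ρ e) : ∃ v : M.Level → ℝ, ∀ a : ℕ, a ≤ (e : ℕ) → ∀ᵐ g ∂M.gain,
      expectedReward M.coding M.m M.hbar g a + M.nextValue v e a ≤
        expectedReward M.coding M.m M.hbar g (ρ e g) + M.nextValue v e (ρ e g) := by
  have hρ := hosp.policy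
  have hP := transition_mem_rowStochastic hρ
  have hreach := hosp.unichain.reaches hρ he
  obtain ⟨c, v, hv⟩ := exists_poisson hP hreach (M.levelReward ρ)
  refine ⟨v, fun a ha => ?_⟩
  set J : ℝ → ℕ → ℝ := fun g x =>
    expectedReward M.coding M.m M.hbar g x + M.nextValue v e x with hJ
  have hJmeas : Measurable fun p : ℝ × ℕ => J p.1 p.2 :=
    measurable_from_prod_countable_left fun x =>
      (measurable_expectedReward M.coding M.one_le_m M.hbar_pos x).add_const (M.nextValue v e x)
  set A : Set ℝ := {g | J g (ρ e g) < J g a} with hA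
  have hAmeas : MeasurableSet A :=
    measurableSet_lt (hJmeas.comp (measurable_id.prodMk (hρ e).1))
      (hJmeas.comp (measurable_id.prodMk measurable_const))
  classical
  -- Deviating only on `A` makes the improvement pointwise nonnegative, so a vanishing integral
  -- forces it to vanish almost surely.
  set σ : M.Level → ℝ → ℕ := Function.update ρ e (A.piecewise (fun _ => a) (ρ e)) with hσdef
  have hσe : σ e = A.piecewise (fun _ => a) (ρ e) := Function.update_self ..
  have hσne : ∀ i, i ≠ e → σ i = ρ i := fun i hi => Function.update_of_ne hi ..
  have hσ : M.IsPolicy σ := by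
    intro i
    by_cases hi : i = e
    · rw [hi, hσe]
      refine ⟨measurable_const.piecewise hAmeas (hρ e).1, fun g => ?_⟩
      by_cases hg : g ∈ A
      · rwa [piecewise_eq_of_mem _ _ _ hg]
      · rw [piecewise_eq_of_notMem _ _ _ hg]
        exact (hρ e).2 g
    · rw [hσne i hi]
      exact hρ i
  have hQ := transition_mem_rowStochastic hσ
  have hrow : ∀ i, i ≠ e → M.transition σ i = M.transition ρ i := fun i hi => by
    funext j
    simp only [transition, hσne i hi]
  have hreach' : ∀ i, ChainReaches (M.transition σ) i e := fun i =>
    (hreach i).of_eq_off hP hQ hrow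
  have hint : ∀ τ, M.IsPolicy τ → Integrable (fun g => J g (τ e g)) M.gain := fun τ hτ =>
    (integrable_expectedReward (hτ e).1 (hτ e).2).add (integrable_nextValue v e (hτ e).1)
  have hintJ : ∀ τ, M.IsPolicy τ → ∫ g, J g (τ e g) ∂M.gain =
      M.levelReward τ e + (Matrix.mulVec (M.transition τ) v) e := fun τ hτ => by
    rw [transition_mulVec hτ]
    exact integral_add (integrable_expectedReward (hτ e).1 (hτ e).2)
      (integrable_nextValue v e (hτ e).1)
  set δ : ℝ := ∫ g, (J g (σ e g) - J g (ρ e g)) ∂M.gain with hδ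
  have hδeq : δ = (M.levelReward σ e + (Matrix.mulVec (M.transition σ) v) e) -
      (M.levelReward ρ e + (Matrix.mulVec (M.transition ρ) v) e) := by
    rw [hδ, integral_sub (hint σ hσ) (hint ρ hρ), hintJ σ hσ, hintJ ρ hρ]
  obtain ⟨q, hq0, hq⟩ := exists_frequency_pos hQ hreach'
  -- The old `v` and `c` still solve the Poisson equation of the new chain once the reward at `e` is
  -- lowered by `δ`.
  have hpoisson : ∀ i, c + v i =
      (M.levelReward σ + (-δ) • (Pi.single e 1 : M.Level → ℝ)) i +
        (Matrix.mulVec (M.transition σ) v) i := by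
    intro i
    simp only [Pi.add_apply, Pi.smul_apply, smul_eq_mul]
    by_cases hi : i = e
    · rw [hi, Pi.single_eq_same, hv e, hδeq]
      ring
    · have h1 : M.levelReward σ i = M.levelReward ρ i := by
        simp only [levelReward, hσne i hi]
      have h2 : (Matrix.mulVec (M.transition σ) v) i = (Matrix.mulVec (M.transition ρ) v) i := by
        simp only [Matrix.mulVec, hrow i hi]
      rw [Pi.single_eq_of_ne hi, h1, h2, hv i]
      ring
  have hrate : M.secrecyRate σ e₀ = c + δ * q := by
    refine secrecyRate_eq_of_tendsto hσ hreach' ?_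
    have hlim := (tendsto_cesaro_of_poisson hQ hpoisson e₀).add ((hq e₀).const_mul δ)
    refine hlim.congr fun K => ?_
    rw [cesaro_add_smul]
    ring
  have hrate' : M.secrecyRate ρ e₀ = c :=
    secrecyRate_eq_of_tendsto hρ hreach (tendsto_cesaro_of_poisson hP hv e₀)
  have hopt := hosp.optimal σ hσ (unichain_of_reaches hσ hreach')
  rw [hrate, hrate'] at hopt
  have hδ0 : δ ≤ 0 := by
    by_contra h
    have := mul_pos (not_le.1 h) hq0
    linarith
  have hnonneg : ∀ g, 0 ≤ J g (σ e g) - J g (ρ e g) := by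
    intro g
    rw [hσe]
    by_cases hg : g ∈ A
    · rw [piecewise_eq_of_mem _ _ _ hg]
      exact sub_nonneg.2 (le_of_lt hg)
    · rw [piecewise_eq_of_notMem _ _ _ hg, sub_self]
  have hzero := (integral_eq_zero_iff_of_nonneg hnonneg ((hint σ hσ).sub (hint ρ hρ))).1
    (le_antisymm hδ0 (integral_nonneg hnonneg))
  filter_upwards [hzero] with g hg
  by_contra hlt
  have hgA : g ∈ A := not_le.1 hlt
  have : J g (σ e g) - J g (ρ e g) = 0 := hg
  rw [hσe, piecewise_eq_of_mem _ _ _ hgA] at this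
  have h2 : J g (ρ e g) < J g a := hgA
  linarith

/-- An OSP is almost surely monotone in the legitimate gain at the recurrent levels. -/
lemma IsOSP.exists_monotone_set {e₀ : M.Level} (hosp : M.IsOSP e₀ ρ) :
    ∃ S : Set ℝ, (∀ᵐ g ∂M.gain, g ∈ S) ∧ ∀ e : M.Level, M.Recurrent ρ e →
      ∀ g' ∈ S, ∀ g'' ∈ S, g' ≤ g'' → ρ e g' ≤ ρ e g'' := by
  choose! v hv using fun (e : M.Level) (he : M.Recurrent ρ e) => hosp.exists_value he
  refine ⟨{g | 0 ≤ g ∧ ∀ e : M.Level, M.Recurrent ρ e → ∀ a : ℕ, a ≤ (e : ℕ) →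
      expectedReward M.coding M.m M.hbar g a + M.nextValue (v e) e a ≤
        expectedReward M.coding M.m M.hbar g (ρ e g) + M.nextValue (v e) e (ρ e g)}, ?_, ?_⟩
  · refine M.gain_nonneg.and (ae_all_iff.2 fun e => ?_)
    by_cases he : M.Recurrent ρ e
    · filter_upwards [ae_all_iff.2 fun a : ℕ => (ae_all_iff.2 fun ha => hv e he a ha)]
        with g hg _
      exact hg
    · exact ae_of_all _ fun g h => absurd h he
  · rintro e he g' ⟨h0', h'⟩ g'' ⟨h0'', h''⟩ hle
    rcases hle.eq_or_lt with rfl | hlt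
    · exact le_rfl
    by_contra hcon
    -- Each of the two actions is tested at the gain where the other is chosen. Adding the
    -- optimality inequalities cancels the continuation values and contradicts the strict increase.
    have hmono := strictMonoOn_expectedReward_sub M.coding M.one_le_m M.hbar_pos
      (Nat.cast_nonneg (ρ e g'')) (Nat.cast_lt.2 (not_le.1 hcon)) h0' h0'' hlt
    have h1 := h' e he (ρ e g'') ((hosp.policy e).2 _)
    have h2 := h'' e he (ρ e g') ((hosp.policy e).2 _)
    simp only at hmono
    linarith

/-! ### Changes on null sets of gains and monotone extension. -/

lemma transition_congr {σ : M.Level → ℝ → ℕ} (h : ∀ᵐ g ∂M.gain, ∀ e, σ e g = ρ e g) :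
    M.transition σ = M.transition ρ := by
  ext e e'
  refine Finset.sum_congr rfl fun b _ => ?_
  congr 1
  refine measureReal_congr ?_
  filter_upwards [h] with g hg
  exact congrArg (fun x => M.nextLevel e x b = e') (hg e)

lemma recurrent_congr {σ : M.Level → ℝ → ℕ} (h : ∀ᵐ g ∂M.gain, ∀ e, σ e g = ρ e g)
    (e : M.Level) : M.Recurrent σ e ↔ M.Recurrent ρ e := by
  simp only [Recurrent, Reaches, transition_congr h]

/-- Optimality only depends on the actions up to a null set of gains. -/
lemma IsOSP.congr {e₀ : M.Level} (hosp : M.IsOSP e₀ ρ) {σ : M.Level → ℝ → ℕ}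
    (hσ : M.IsPolicy σ) (h : ∀ᵐ g ∂M.gain, ∀ e, σ e g = ρ e g) : M.IsOSP e₀ σ := by
  have hrate : M.secrecyRate σ e₀ = M.secrecyRate ρ e₀ := by
    refine Finset.sum_congr rfl fun e _ => ?_
    simp only [longTermProb, transition_congr h]
    congr 1
    refine integral_congr_ae ?_
    filter_upwards [h] with g hg
    rw [hg e]
  refine ⟨hσ, ?_, fun τ hτ hu => hrate ▸ hosp.optimal τ hτ hu⟩
  intro e e' he he'
  have := hosp.unichain e e' ((recurrent_congr h e).1 he) ((recurrent_congr h e').1 he')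
  simpa only [Reaches, transition_congr h] using this

open Classical in
/-- The smallest monotone extension to all gains of the restriction of `ρ` to the recurrent levels
and the gains in `S`. -/
def monotoneEnvelope (ρ : M.Level → ℝ → ℕ) (S : Set ℝ) (e : M.Level) (g : ℝ) : ℕ :=
  if M.Recurrent ρ e then sSup (ρ e '' (S ∩ Iic g)) else 0

lemma monotone_monotoneEnvelope (hρ : M.IsPolicy ρ) (S : Set ℝ) (e : M.Level) :
    Monotone (monotoneEnvelope ρ S e) := by
  intro g g' hg
  unfold monotoneEnvelope
  split_ifs
  -- The level `e` bounds all values; if no point of `S` lies below `g`, the supremum in `ℕ` is 0.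
  · refine csSup_le' fun y hy => le_csSup ⟨e, ?_⟩
      (image_mono (inter_subset_inter_right S (Iic_subset_Iic.2 hg)) hy)
    rintro _ ⟨x, -, rfl⟩
    exact (hρ e).2 x
  · exact le_rfl

/-- Measurability comes from monotonicity, so `S` need not be measurable. -/
lemma isPolicy_monotoneEnvelope (hρ : M.IsPolicy ρ) (S : Set ℝ) :
    M.IsPolicy (monotoneEnvelope ρ S) := by
  refine fun e => ⟨(monotone_monotoneEnvelope hρ S e).measurable, fun g => ?_⟩
  unfold monotoneEnvelope
  split_ifs
  · refine csSup_le' ?_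
    rintro _ ⟨x, -, rfl⟩
    exact (hρ e).2 x
  · exact Nat.zero_le _

lemma monotoneEnvelope_eq {S : Set ℝ} {e : M.Level} (he : M.Recurrent ρ e)
    (hS : ∀ g' ∈ S, ∀ g'' ∈ S, g' ≤ g'' → ρ e g' ≤ ρ e g'') {g : ℝ} (hg : g ∈ S) :
    monotoneEnvelope ρ S e g = ρ e g := by
  rw [monotoneEnvelope, if_pos he]
  refine IsGreatest.csSup_eq ⟨⟨g, ⟨hg, self_mem_Iic⟩, rfl⟩, ?_⟩
  rintro _ ⟨x, ⟨hx, hxg⟩, rfl⟩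
  exact hS x hx g hg hxg

end Model

end EHSecrecy

end

theorem theorem4 :
    -- monotonicity of the optimal transmission power, for either coding strategy
    (∀ (M : EHSecrecy.Model) (e₀ : M.Level) (ρ : M.Level → ℝ → ℕ), M.IsOSP e₀ ρ →
      (∃ S : Set ℝ, (∀ᵐ g ∂M.gain, g ∈ S) ∧
        ∀ e : M.Level, M.Recurrent ρ e →
          ∀ g' ∈ S, ∀ g'' ∈ S, g' ≤ g'' → ρ e g' ≤ ρ e g'') ∧
      (M.SilentOnTransient ρ →
        ∃ ρ' : M.Level → ℝ → ℕ, M.IsOSP e₀ ρ' ∧ M.SilentOnTransient ρ' ∧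
          (∀ᵐ g ∂M.gain, ∀ e, ρ' e g = ρ e g) ∧
          ∀ e : M.Level, ∀ g' g'' : ℝ, g' ≤ g'' → ρ' e g' ≤ ρ' e g'')) ∧
    -- the mixed partial derivative of the expected secrecy reward
    (∀ m hbar : ℝ, 1 ≤ m → 0 < hbar →
      EHSecrecy.HasMixedPartial (EHSecrecy.expectedReward .con m hbar)
        (fun g ρ => 1 / Real.log 2 * (1 / (1 + g * ρ) ^ 2)) ∧
      EHSecrecy.HasMixedPartial (EHSecrecy.expectedReward .var m hbar)
        (fun g ρ => 1 / Real.log 2 *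
          ((Real.Gamma m - EHSecrecy.upperGamma m (m * g / hbar)) /
            ((1 + g * ρ) ^ 2 * Real.Gamma m))) ∧
      ∀ g ρ : ℝ, 0 ≤ g → 0 ≤ ρ →
        0 ≤ 1 / Real.log 2 * (1 / (1 + g * ρ) ^ 2) ∧
        0 ≤ 1 / Real.log 2 *
          ((Real.Gamma m - EHSecrecy.upperGamma m (m * g / hbar)) /
            ((1 + g * ρ) ^ 2 * Real.Gamma m))) := by
  refine ⟨fun M e₀ ρ hosp => ⟨hosp.exists_monotone_set, fun hsilent => ?_⟩,
    fun m hbar hm hh => ?_⟩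
  · obtain ⟨S, hS, hmono⟩ := hosp.exists_monotone_set
    have hae : ∀ᵐ g ∂M.gain, ∀ e, EHSecrecy.Model.monotoneEnvelope ρ S e g = ρ e g := by
      filter_upwards [hS] with g hg e
      by_cases he : M.Recurrent ρ e
      · exact EHSecrecy.Model.monotoneEnvelope_eq he (hmono e he) hg
      · rw [EHSecrecy.Model.monotoneEnvelope, if_neg he, hsilent e he g]
    refine ⟨EHSecrecy.Model.monotoneEnvelope ρ S,
      hosp.congr (EHSecrecy.Model.isPolicy_monotoneEnvelope hosp.policy S) hae,
      fun e he g => ?_, hae,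
      fun e g' g'' h => EHSecrecy.Model.monotone_monotoneEnvelope hosp.policy S e h⟩
    rw [EHSecrecy.Model.recurrent_congr hae] at he
    rw [EHSecrecy.Model.monotoneEnvelope, if_neg he]
  · have hG : 0 < Real.Gamma m := Real.Gamma_pos_of_pos (by linarith)
    have hlog := Real.log_pos one_lt_two
    have hF : ∀ g : ℝ, 0 ≤ g → EHSecrecy.activeProb .var m hbar g =
        (Real.Gamma m - EHSecrecy.upperGamma m (m * g / hbar)) / Real.Gamma m :=
      fun g hg => EHSecrecy.nakagamiGain_real_Iio hm hh hg
    refine ⟨?_, ?_, fun g ρ hg hρ => ⟨by positivity, ?_⟩⟩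
    · obtain ⟨D, hD⟩ := EHSecrecy.hasMixedPartial_expectedReward .con hm hh
      refine ⟨D, fun g ρ hg hρ => ⟨(hD g ρ hg hρ).1, (hD g ρ hg hρ).2.congr_deriv ?_⟩⟩
      simp only [EHSecrecy.activeProb]
      ring
    · obtain ⟨D, hD⟩ := EHSecrecy.hasMixedPartial_expectedReward .var hm hh
      refine ⟨D, fun g ρ hg hρ => ⟨(hD g ρ hg hρ).1, (hD g ρ hg hρ).2.congr_deriv ?_⟩⟩
      simp only [hF g hg]
      field_simp
    -- The sign comes from reading the Gamma quotient as the probability `P(H < g)`.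
    · have h0 : 0 ≤ EHSecrecy.activeProb .var m hbar g := MeasureTheory.measureReal_nonneg
      rw [hF g hg] at h0
      rw [mul_comm ((1 + g * ρ) ^ 2), ← div_div]
      positivity
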